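/- **Setting.** A game graph $\mathcal G=\langle V,V_0,V_1,E\rangle$ consists of a finite non-empty vertex set $V=V_0\uplus V_1$, with $n=|V|$, and edges $E\subseteq V\times V$ such that every vertex has at least one successor. Player $i$ chooses the successor at vertices in $V_i$, by a strategy that may depend on the whole history. A set $E^\ell\subseteq (V_1\times V)\cap E$ of *live edges* is given. A play $\pi$ is *fair* if, for every $(v,w)\in E^\ell$, whenever $\pi$ visits $v$ infinitely often it takes the edge $(v,w)$ infinitely often. Let $r,s\ge 1$ and $A_1,\dots,A_r,F_1,\dots,F_s\subseteq V$. The GR(1) condition is $$\varphi=\Big(\bigwedge_{a=1}^{r}\Box\Diamond A_a\Big)\rightarrow\Big(\bigwedge_{b=1}^{s}\Box\Diamond F_b\Big).$$ Player 0 wins the fair adversarial GR(1) game from $v$ if she has a strategy such that every compliant play from $v$ that is fair satisfies $\varphi$; the winning region $\mathcal W$ is the set of these $v$. A strategy is *winning* from $v$ if it is a witness for this. For $S,T\subseteq V$ put $$\mathrm{Pre}^{\forall}_1(S)=\{v\in V_1: E(v)\subseteq S\},\qquad \mathrm{Cpre}(S)=\{v\in V_0: E(v)\cap S\ne\emptyset\}\cup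 \mathrm{Pre}^{\forall}_1(S),$$ $$\mathrm{Lpre}^{\exists}(S)=\{v: E^\ell(v)\cap S\neq\emptyset\},\qquad \mathrm{Apre}(S,T)=\mathrm{Cpre}(T)\cup(\mathrm{Lpre}^{\exists}(T)\cap \mathrm{Pre}^{\forall}_1(S)).$$ **Theorem.** Let $$Z^*=\nu Y.\ \bigcap_{b=1}^{s}\ \mu X_b.\ \bigcup_{a=1}^{r}\ \nu Y_a.\ \big(F_b\cap\mathrm{Cpre}(Y)\big)\cup\mathrm{Apre}(Y,X_b)\cup\big(\overline{A}_a\cap\mathrm{Cpre}(Y_a)\big).$$ 1. $Z^*=\mathcal W$. 2. The accelerated fixpoint iteration computes $Z^*$ in $O(n^2rs)$ symbolic steps, with an absolute constant. Here the fixpoints are evaluated by nested iteration, where $Y$ starts from $V$, each $X_b$ starts from $\emptyset$, and the iteration over $Y_a$ in the $i$-th round over $X_b$ is warm-started from the value of $Y_a$ that was most recently computed in an $i$-th round over $X_b$ (from $V$ if there is none). A symbolic step is one application of $\mathrm{Cpre}$, $\mathrm{Lpre}^\exists$ or $\mathrm{Pre}^\forall_1$, one union, intersection or complement, or one comparison of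 two sets. 3. A finite-memory strategy of player 0 that is winning from every vertex of $Z^*$ can be extracted from the sets the algorithm has stored when it stops: writing $Y_{b,i,a}$ for the stored value of $Y_a$ in round $i$ over $X_b$, and $\mathrm{rank}_b(v)$ for the lexicographically least $(i,a)$ with $v\in Y_{b,i,a}$ (and $\infty$ if there is none), there is such a strategy with memory $\{1,\dots,s\}$ which at $v\in V_0$ with memory $b$ moves to a successor of minimal $\mathrm{rank}_{b'}$, where $b'$, the next memory value, is the cyclic successor of $b$ if $v\in F_b$ and $b'=b$ otherwise (the memory is also updated in this way at $v\in V_1$). -/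

import Mathlib

open Filter

/-! ## Game graphs with live edges -/

/-- A two-player game graph: the vertices are the elements of `V`, player 0 owns the vertices in
`V0` and player 1 owns all the others; `E` is the edge relation. -/
structure GameGraph (V : Type*) where
  V0 : Set V
  E : V → V → Prop

namespace GameGraph

variable {V : Type*} (G : GameGraph V)

/-- The vertices of player 1. -/
def V1 : Set V := G.V0ᶜ

/-- A strategy for the player who owns the vertices in `S`. `next w v` is the successor chosen
after the history `w · v`; only its values at `v ∈ S` matter. -/
structure Strategy (S : Set V) where
  next : List V → V → V
  valid : ∀ w, ∀ v ∈ S, G.E v (next w v)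

/-- The history `w · v` of the compliant play after `i` moves, as the pair `(w, v)`. -/
noncomputable def history (ρ₀ : G.Strategy G.V0) (ρ₁ : G.Strategy G.V1) (v₀ : V) : ℕ → List V × V
  | 0 => ([], v₀)
  | i + 1 =>
    let h := history ρ₀ ρ₁ v₀ i
    open Classical in
    (h.1 ++ [h.2], if h.2 ∈ G.V0 then ρ₀.next h.1 h.2 else ρ₁.next h.1 h.2)

/-- The unique play from `v₀` compliant with `ρ₀` and `ρ₁`. -/
noncomputable def play (ρ₀ : G.Strategy G.V0) (ρ₁ : G.Strategy G.V1) (v₀ : V) : ℕ → V :=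
  fun i => (G.history ρ₀ ρ₁ v₀ i).2

/-- `ρ₀` is winning from `v` for the winning condition `φ`. -/
def WinsWith (φ : Set (ℕ → V)) (ρ₀ : G.Strategy G.V0) (v : V) : Prop :=
  ∀ ρ₁ : G.Strategy G.V1, G.play ρ₀ ρ₁ v ∈ φ

/-- The winning region of player 0. -/
def winningRegion (φ : Set (ℕ → V)) : Set V :=
  {v | ∃ ρ₀ : G.Strategy G.V0, G.WinsWith φ ρ₀ v}

/-- A player 0 strategy whose dependence on the past is only through a memory in `M`. -/
structure MemoryStrategy (M : Type*) where
  init : M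
  update : M → V → M
  move : M → V → V
  valid : ∀ m, ∀ v ∈ G.V0, G.E v (move m v)

/-- The strategy implemented by a memory structure: the memory reads the past `w`. -/
def MemoryStrategy.toStrategy {G : GameGraph V} {M : Type*} (σ : G.MemoryStrategy M) :
    G.Strategy G.V0 where
  next w v := σ.move (w.foldl σ.update σ.init) v
  valid _ v hv := σ.valid _ v hv

end GameGraph

/-- A game graph with live edges: some edges that leave player 1 vertices are marked as live. -/
structure LiveGame (V : Type*) extends GameGraph V where
  live : V → V → Prop
  live_sub : ∀ v w, live v w → v ∈ toGameGraph.V1 ∧ E v w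

/-- The plays satisfying the GR(1) condition `(⋀ₐ □◇ Aₐ) → (⋀_b □◇ F_b)`. -/
def GR1Condition {V : Type*} {r s : ℕ} (A : Fin r → Set V) (F : Fin s → Set V) : Set (ℕ → V) :=
  {π | (∀ a, ∃ᶠ i in atTop, π i ∈ A a) → ∀ b, ∃ᶠ i in atTop, π i ∈ F b}

namespace LiveGame

section SetTransformers

variable {V : Type*} (G : LiveGame V)

/-- Strong transition fairness: if `v` is visited infinitely often, every live edge leaving `v`
is taken infinitely often. -/
def Fair (π : ℕ → V) : Prop :=
  ∀ v w, G.live v w → (∃ᶠ i in atTop, π i = v) → ∃ᶠ i in atTop, π i = v ∧ π (i + 1) = w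

/-- Winning condition of the fair adversarial game for `φ`. -/
def fairCondition (φ : Set (ℕ → V)) : Set (ℕ → V) := {π | G.Fair π → π ∈ φ}

/-- Winning region of player 0 in the fair adversarial game for `φ`. -/
def fairWinningRegion (φ : Set (ℕ → V)) : Set V := G.winningRegion (G.fairCondition φ)

def preE0 (S : Set V) : Set V := {v | v ∈ G.V0 ∧ ∃ w, G.E v w ∧ w ∈ S}

def preA1 (S : Set V) : Set V := {v | v ∈ G.V1 ∧ ∀ w, G.E v w → w ∈ S}

def cpre (S : Set V) : Set V := G.preE0 S ∪ G.preA1 S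

def lpre (S : Set V) : Set V := {v | ∃ w, G.live v w ∧ w ∈ S}

def apre (S T : Set V) : Set V := G.cpre T ∪ (G.lpre T ∩ G.preA1 S)

theorem preE0_mono : Monotone G.preE0 :=
  fun _ _ h _ hv => ⟨hv.1, hv.2.imp fun _ hw => ⟨hw.1, h hw.2⟩⟩

theorem preA1_mono : Monotone G.preA1 := fun _ _ h _ hv => ⟨hv.1, fun w hw => h (hv.2 w hw)⟩

theorem cpre_mono : Monotone G.cpre :=
  fun _ _ h => Set.union_subset_union (G.preE0_mono h) (G.preA1_mono h)

theorem lpre_mono : Monotone G.lpre := fun _ _ h _ hv => hv.imp fun _ hw => ⟨hw.1, h hw.2⟩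

theorem apre_mono {S S' T T' : Set V} (hS : S ⊆ S') (hT : T ⊆ T') : G.apre S T ⊆ G.apre S' T' :=
  Set.union_subset_union (G.cpre_mono hT) (Set.inter_subset_inter (G.lpre_mono hT) (G.preA1_mono hS))

/-! ## The fixpoint -/

/-- `(F_b ∩ Cpre(Y)) ∪ Apre(Y, X) ∪ (Āₐ ∩ Cpre(W))`, where `W` stands for `Yₐ`. -/
def gr1Body (Aa Fb Y X W : Set V) : Set V :=
  (Fb ∩ G.cpre Y) ∪ G.apre Y X ∪ (Aaᶜ ∩ G.cpre W)

theorem gr1Body_mono (Aa Fb : Set V) {Y Y' X X' W W' : Set V} (hY : Y ⊆ Y') (hX : X ⊆ X')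
    (hW : W ⊆ W') : G.gr1Body Aa Fb Y X W ⊆ G.gr1Body Aa Fb Y' X' W' :=
  Set.union_subset_union
    (Set.union_subset_union (Set.inter_subset_inter_right _ (G.cpre_mono hY)) (G.apre_mono hY hX))
    (Set.inter_subset_inter_right _ (G.cpre_mono hW))

/-- `ν Yₐ. (F_b ∩ Cpre(Y)) ∪ Apre(Y, X) ∪ (Āₐ ∩ Cpre(Yₐ))` -/
def gr1Nu (Aa Fb Y X : Set V) : Set V :=
  OrderHom.gfp ⟨G.gr1Body Aa Fb Y X, fun _ _ h => G.gr1Body_mono Aa Fb subset_rfl subset_rfl h⟩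

theorem gr1Nu_mono (Aa Fb : Set V) {Y Y' X X' : Set V} (hY : Y ⊆ Y') (hX : X ⊆ X') :
    G.gr1Nu Aa Fb Y X ⊆ G.gr1Nu Aa Fb Y' X' :=
  OrderHom.gfp.mono fun _ => G.gr1Body_mono Aa Fb hY hX subset_rfl

variable {r s : ℕ} (A : Fin r → Set V) (F : Fin s → Set V)

/-- `μ X. ⋃ₐ ν Yₐ. (F_b ∩ Cpre(Y)) ∪ Apre(Y, X) ∪ (Āₐ ∩ Cpre(Yₐ))` -/
def gr1Mu (Fb Y : Set V) : Set V :=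
  OrderHom.lfp ⟨fun X => ⋃ a, G.gr1Nu (A a) Fb Y X,
    fun _ _ h => Set.iUnion_mono fun a => G.gr1Nu_mono (A a) Fb subset_rfl h⟩

theorem gr1Mu_mono (Fb : Set V) {Y Y' : Set V} (hY : Y ⊆ Y') :
    G.gr1Mu A Fb Y ⊆ G.gr1Mu A Fb Y' :=
  OrderHom.lfp.mono fun _ => Set.iUnion_mono fun a => G.gr1Nu_mono (A a) Fb hY subset_rfl

/-- `Z* = ν Y. ⋂_b μ X_b. ⋃ₐ ν Yₐ. (F_b ∩ Cpre(Y)) ∪ Apre(Y, X_b) ∪ (Āₐ ∩ Cpre(Yₐ))` -/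
def gr1Fixpoint : Set V :=
  OrderHom.gfp ⟨fun Y => ⋂ b, G.gr1Mu A (F b) Y,
    fun _ _ h => Set.iInter_mono fun b => G.gr1Mu_mono A (F b) h⟩

end SetTransformers

end LiveGame

/-! ## Symbolic computations -/

/-- The result of a symbolic computation together with the number of symbolic steps it took. -/
structure Symbolic (α : Type*) where
  val : α
  steps : ℕ

namespace Symbolic

instance : Monad Symbolic where
  pure x := ⟨x, 0⟩
  bind x f := ⟨(f x.val).val, x.steps + (f x.val).steps⟩

/-- A primitive operation on sets of vertices: one symbolic step. -/
def op {α : Type*} (x : α) : Symbolic α := ⟨x, 1⟩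

/-- Greatest fixpoint iteration: replace the current set `W` by `W ∩ body W` until it no longer
changes. A store `t` is threaded through the rounds. A round costs the steps of `body`, one for the
intersection, and one for the comparison. -/
noncomputable def descend {V τ : Type*} [Finite V] (body : Set V → τ → Symbolic (Set V × τ))
    (W : Set V) (t : τ) : Symbolic (Set V × τ) :=
  let o := body W t
  open Classical in
  if h : W ∩ o.val.1 = W then ⟨(W, o.val.2), o.steps + 2⟩
  else
    let q := descend body (W ∩ o.val.1) o.val.2
    ⟨q.val, o.steps + 2 + q.steps⟩
termination_by W.ncard
decreasing_by
  exact Set.ncard_lt_ncard (Set.inter_subset_left.ssubset_of_ne h) (Set.toFinite _)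

/-- Least fixpoint iteration: replace the current set `X` by `X ∪ body X` until it no longer
changes. The body also gets the number `i` of the round and a store. -/
noncomputable def ascend {V τ : Type*} [Finite V] (body : ℕ → Set V → τ → Symbolic (Set V × τ))
    (i : ℕ) (X : Set V) (t : τ) : Symbolic (Set V × τ) :=
  let o := body i X t
  open Classical in
  if h : X ∪ o.val.1 = X then ⟨(X, o.val.2), o.steps + 2⟩
  else
    let q := ascend body (i + 1) (X ∪ o.val.1) o.val.2
    ⟨q.val, o.steps + 2 + q.steps⟩
termination_by Xᶜ.ncard
decreasing_by
  refine Set.ncard_lt_ncard (compl_lt_compl_iff_lt.2 ?_) (Set.toFinite _)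
  exact Set.subset_union_left.ssubset_of_ne (Ne.symm h)

end Symbolic

namespace LiveGame

open Symbolic

section Algorithm

variable {V : Type*} [Finite V] (G : LiveGame V)

/-- Symbolic evaluation of `Apre(Y, X)`. -/
def symApre (Y X : Set V) : Symbolic (Set V) := do
  let c ← op (G.cpre X)
  let l ← op (G.lpre X)
  let p ← op (G.preA1 Y)
  let m ← op (l ∩ p)
  op (c ∪ m)

/-- Symbolic evaluation of `(F_b ∩ Cpre(Y)) ∪ Apre(Y, X) ∪ (Āₐ ∩ Cpre(W))`. -/
def symBody (Aa Fb Y X W : Set V) : Symbolic (Set V) := do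
  let c ← op (G.cpre Y)
  let t₁ ← op (Fb ∩ c)
  let t₂ ← G.symApre Y X
  let nA ← op Aaᶜ
  let d ← op (G.cpre W)
  let t₃ ← op (nA ∩ d)
  let u ← op (t₁ ∪ t₂)
  op (u ∪ t₃)

/-- The store of the algorithm: at `b`, `i`, `a` it holds the value of `Yₐ` that was computed most
recently in round `i` of the iteration over `X_b`, and all of `V` if there is none yet. -/
abbrev Store (V : Type*) (r s : ℕ) : Type _ := Fin s → ℕ → Fin r → Set V

def Store.set {V : Type*} {r s : ℕ} (T : Store V r s) (b : Fin s) (i : ℕ) (a : Fin r) (W : Set V) :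
    Store V r s :=
  fun b' i' a' => if b' = b ∧ i' = i ∧ a' = a then W else T b' i' a'

variable {r s : ℕ} (A : Fin r → Set V) (F : Fin s → Set V)

/-- One round of the iteration over `X_b`: compute `⋃ₐ ν Yₐ. …`, where the iteration over `Yₐ`
is warm-started from the store. -/
noncomputable def symRound (b : Fin s) (Y : Set V) (i : ℕ) (X : Set V) (T : Store V r s) :
    Symbolic (Set V × Store V r s) :=
  (List.finRange r).foldlM (init := (∅, T)) fun UT a => do
    let W ← descend (fun W (t : PUnit) => do
      let W' ← G.symBody (A a) (F b) Y X W
      pure (W', t)) (UT.2 b i a) PUnit.unit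
    let U ← op (UT.1 ∪ W.1)
    pure (U, UT.2.set b i a W.1)

/-- One round of the iteration over `Y`: compute `⋂_b μ X_b. …`. -/
noncomputable def symOuter (Y : Set V) (T : Store V r s) : Symbolic (Set V × Store V r s) :=
  (List.finRange s).foldlM (init := (Set.univ, T)) fun JT b => do
    let X ← ascend (G.symRound A F b Y) 0 ∅ JT.2
    let J ← op (JT.1 ∩ X.1)
    pure (J, X.2)

/-- The (accelerated) symbolic fixpoint algorithm. It returns the computed set of vertices and the
final store. -/
noncomputable def gr1Algorithm : Symbolic (Set V × Store V r s) :=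
  descend (G.symOuter A F) Set.univ fun _ _ _ => Set.univ

end Algorithm

section Extraction

variable {V : Type*} (G : LiveGame V) {r s : ℕ}

/-- The rank of `v` while goal `b` is pursued: the lexicographically least pair `(i, a)` such that
`v` belongs to the set stored at `b`, `i`, `a`; the pair `(i, a)` is encoded as `i * r + a`. -/
noncomputable def rank (T : Store V r s) (b : Fin s) (v : V) : ℕ∞ :=
  ⨅ (i : ℕ) (a : Fin r) (_ : v ∈ T b i a), ((i * r + (a : ℕ) : ℕ) : ℕ∞)

/-- `σ` is extracted from the store `T`: the memory is the goal currently pursued, the goals are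
pursued cyclically, and player 0 always moves to a successor of minimal rank for the pursued goal. -/
structure IsExtracted [NeZero s] (F : Fin s → Set V) (T : Store V r s)
    (σ : G.MemoryStrategy (Fin s)) : Prop where
  update_of_mem : ∀ b v, v ∈ F b → σ.update b v = b + 1
  update_of_notMem : ∀ b v, v ∉ F b → σ.update b v = b
  move_min : ∀ b, ∀ v ∈ G.V0, ∀ w, G.E v w →
    rank T (σ.update b v) (σ.move b v) ≤ rank T (σ.update b v) w

end Extraction

end LiveGame

/-! Soundness (`IsExtracted.winsWith`). At `Y = Z*` every inner least fixpoint equals `Z*`, so a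
strategy that pursues the goals cyclically and minimises the rank stays in `Z*`. Suppose that from
some time on it pursues one goal `b` and never meets `F b`. Let `(i, a)` be the least rank among the
vertices visited infinitely often. At a vertex of this rank the `Cpre` part of `Apre` would lower
the rank, and its live part would by fairness make a vertex of stage `i` recurrent; minimality
excludes both. The remaining disjunct avoids `A a` and keeps the rank, so `A a` is met only finitely
often.

Completeness (`fairWinningRegion_subset_gr1Mu`). The winning region `Y` is a post-fixpoint of the
outer operator. From outside `M = gr1Mu A (F b) Y`, player 1 takes the successors outside `M` in
turn. Either player 1 gets a chance to leave `Y` and wins from there, or the play is fair, avoids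
`M` and `F b`, and meets every `A a` infinitely often: otherwise its recurrent vertices together
with `M` would form a post-fixpoint and lie in `M`.

Cost (`gr1Algorithm_spec`). As `Y` shrinks, the stored sets stay above the new fixpoints, so warm
starts are sound. An iteration over `Yₐ` costs a constant plus a constant per vertex removed from
its stored set. There are `O(n² r s)` iterations, and since stored sets only shrink, `O(n² r s)`
removals, counted by `Store.potential`. -/

namespace Symbolic

/-! ### Cost accounting for fixpoint iterations. -/

section Basic

universe u

variable {α β : Type u}

@[simp] theorem val_pure (x : α) : (pure x : Symbolic α).val = x := rfl

@[simp] theorem steps_pure (x : α) : (pure x : Symbolic α).steps = 0 := rfl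

@[simp] theorem val_op (x : α) : (op x).val = x := rfl

@[simp] theorem steps_op (x : α) : (op x).steps = 1 := rfl

@[simp] theorem val_bind (x : Symbolic α) (f : α → Symbolic β) :
    (x >>= f).val = (f x.val).val := rfl

@[simp] theorem steps_bind (x : Symbolic α) (f : α → Symbolic β) :
    (x >>= f).steps = x.steps + (f x.val).steps := rfl

end Basic

variable {V τ : Type*} [Finite V]

/-- A descending iteration stops at a set that its body does not shrink; an invariant `P` of the
rounds holds there, and the steps are bounded with the help of a potential `Φ` on the store. -/
theorem descend_spec {body : Set V → τ → Symbolic (Set V × τ)} {P : Set V → τ → Prop}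
    {Φ : τ → ℕ} {K : ℕ}
    (hP : ∀ W t, P W t → P (W ∩ (body W t).val.1) (body W t).val.2)
    (hK : ∀ W t, P W t → (body W t).steps + Φ (body W t).val.2 ≤ K + Φ t)
    {W : Set V} {t : τ} (h : P W t) {q : Symbolic (Set V × τ)} (hq : descend body W t = q) :
    ∃ t', P q.val.1 t' ∧ q.val.1 ⊆ (body q.val.1 t').val.1 ∧ q.val.2 = (body q.val.1 t').val.2 ∧
      q.steps + Φ q.val.2 + (K + 2) * q.val.1.ncard ≤ (K + 2) * (W.ncard + 1) + Φ t := by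
  induction hn : W.ncard using Nat.strong_induction_on generalizing W t q with
  | _ n ih =>
    subst hn
    have hKW := hK W t h
    unfold descend at hq
    dsimp only at hq
    split at hq
    · rename_i hW
      subst hq
      refine ⟨t, h, Set.inter_eq_left.1 hW, rfl, ?_⟩
      dsimp only
      linarith
    · rename_i hW
      subst hq
      have hlt : (W ∩ (body W t).val.1).ncard < W.ncard :=
        Set.ncard_lt_ncard (Set.inter_subset_left.ssubset_of_ne hW) (Set.toFinite _)
      obtain ⟨t', h₁, h₂, h₃, h₄⟩ := ih _ hlt (hP W t h) rfl rfl
      refine ⟨t', h₁, h₂, h₃, ?_⟩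
      dsimp only
      -- A round that is not the last removes a vertex, which pays for its `K + 2` steps.
      have := Nat.mul_le_mul_left (K + 2) (Nat.succ_le_of_lt hlt)
      simp only [Nat.succ_eq_add_one] at this
      linarith

/-- The counterpart of `descend_spec` for ascending iterations. -/
theorem ascend_spec {body : ℕ → Set V → τ → Symbolic (Set V × τ)} {P : ℕ → Set V → τ → Prop}
    {Φ : τ → ℕ} {K : ℕ}
    (hP : ∀ i X t, P i X t → X ∪ (body i X t).val.1 ≠ X →
      P (i + 1) (X ∪ (body i X t).val.1) (body i X t).val.2)
    (hK : ∀ i X t, P i X t → (body i X t).steps + Φ (body i X t).val.2 ≤ K + Φ t)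
    {i : ℕ} {X : Set V} {t : τ} (h : P i X t) {q : Symbolic (Set V × τ)}
    (hq : ascend body i X t = q) :
    ∃ j t', P j q.val.1 t' ∧ (body j q.val.1 t').val.1 ⊆ q.val.1 ∧
      q.val.2 = (body j q.val.1 t').val.2 ∧
      q.steps + Φ q.val.2 ≤ (K + 2) * (Xᶜ.ncard + 1) + Φ t := by
  induction hn : Xᶜ.ncard using Nat.strong_induction_on generalizing i X t q with
  | _ n ih =>
    subst hn
    have hKX := hK i X t h
    unfold ascend at hq
    dsimp only at hq
    split at hq
    · rename_i hX
      subst hq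
      refine ⟨i, t, h, Set.union_eq_left.1 hX, rfl, ?_⟩
      dsimp only
      nlinarith
    · rename_i hX
      subst hq
      have hlt : (X ∪ (body i X t).val.1)ᶜ.ncard < Xᶜ.ncard :=
        Set.ncard_lt_ncard (compl_lt_compl_iff_lt.2
          (Set.subset_union_left.ssubset_of_ne (Ne.symm hX))) (Set.toFinite _)
      obtain ⟨j, t', h₁, h₂, h₃, h₄⟩ := ih _ hlt (hP i X t h hX) rfl rfl
      refine ⟨j, t', h₁, h₂, h₃, ?_⟩
      dsimp only
      have := Nat.mul_le_mul_left (K + 2) (Nat.succ_le_of_lt hlt)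
      simp only [Nat.succ_eq_add_one] at this
      linarith

end Symbolic

/-! ### Fixpoint equations and approximants. -/

namespace LiveGame

open Symbolic

section Fixpoints

variable {V : Type*} (G : LiveGame V) {r s : ℕ} (A : Fin r → Set V) (F : Fin s → Set V)

theorem gr1Body_gr1Nu (Aa Fb Y X : Set V) :
    G.gr1Body Aa Fb Y X (G.gr1Nu Aa Fb Y X) = G.gr1Nu Aa Fb Y X :=
  OrderHom.map_gfp ⟨G.gr1Body Aa Fb Y X, _⟩

theorem subset_gr1Nu {Aa Fb Y X W : Set V} (h : W ⊆ G.gr1Body Aa Fb Y X W) :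
    W ⊆ G.gr1Nu Aa Fb Y X :=
  OrderHom.le_gfp ⟨G.gr1Body Aa Fb Y X, _⟩ h

theorem iUnion_gr1Nu_gr1Mu (Fb Y : Set V) :
    ⋃ a, G.gr1Nu (A a) Fb Y (G.gr1Mu A Fb Y) = G.gr1Mu A Fb Y :=
  OrderHom.map_lfp ⟨fun X => ⋃ a, G.gr1Nu (A a) Fb Y X, _⟩

theorem gr1Mu_subset {Fb Y X : Set V} (h : ⋃ a, G.gr1Nu (A a) Fb Y X ⊆ X) :
    G.gr1Mu A Fb Y ⊆ X :=
  OrderHom.lfp_le ⟨fun X => ⋃ a, G.gr1Nu (A a) Fb Y X, _⟩ h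

theorem iInter_gr1Mu_gr1Fixpoint :
    ⋂ b, G.gr1Mu A (F b) (G.gr1Fixpoint A F) = G.gr1Fixpoint A F :=
  OrderHom.map_gfp ⟨fun Y => ⋂ b, G.gr1Mu A (F b) Y, _⟩

theorem subset_gr1Fixpoint {Y : Set V} (h : Y ⊆ ⋂ b, G.gr1Mu A (F b) Y) :
    Y ⊆ G.gr1Fixpoint A F :=
  OrderHom.le_gfp ⟨fun Y => ⋂ b, G.gr1Mu A (F b) Y, _⟩ h

/-- The approximants of `gr1Mu`, starting from the empty set. -/
def gr1Stage (Fb Y : Set V) : ℕ → Set V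
  | 0 => ∅
  | i + 1 => gr1Stage Fb Y i ∪ ⋃ a, G.gr1Nu (A a) Fb Y (gr1Stage Fb Y i)

theorem gr1Stage_mono (Fb : Set V) {Y Y' : Set V} (hY : Y ⊆ Y') (i : ℕ) :
    G.gr1Stage A Fb Y i ⊆ G.gr1Stage A Fb Y' i := by
  induction i with
  | zero => exact subset_rfl
  | succ i ih =>
    exact Set.union_subset_union ih (Set.iUnion_mono fun a => G.gr1Nu_mono (A a) Fb hY ih)

theorem gr1Stage_monotone (Fb Y : Set V) : Monotone (G.gr1Stage A Fb Y) :=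
  monotone_nat_of_le_succ fun _ => Set.subset_union_left

theorem gr1Nu_subset_gr1Stage (Fb Y : Set V) (i : ℕ) (a : Fin r) :
    G.gr1Nu (A a) Fb Y (G.gr1Stage A Fb Y i) ⊆ G.gr1Stage A Fb Y (i + 1) :=
  (Set.subset_iUnion (fun a => G.gr1Nu (A a) Fb Y (G.gr1Stage A Fb Y i)) a).trans
    Set.subset_union_right

theorem gr1Stage_subset_gr1Mu (Fb Y : Set V) (i : ℕ) :
    G.gr1Stage A Fb Y i ⊆ G.gr1Mu A Fb Y := by
  induction i with
  | zero => exact Set.empty_subset _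
  | succ i ih =>
    refine Set.union_subset ih ?_
    rw [← G.iUnion_gr1Nu_gr1Mu A Fb Y]
    exact Set.iUnion_mono fun a => G.gr1Nu_mono (A a) Fb subset_rfl ih

theorem gr1Stage_eq_gr1Mu {Fb Y : Set V} {i : ℕ}
    (h : ⋃ a, G.gr1Nu (A a) Fb Y (G.gr1Stage A Fb Y i) ⊆ G.gr1Stage A Fb Y i) :
    G.gr1Stage A Fb Y i = G.gr1Mu A Fb Y :=
  (G.gr1Stage_subset_gr1Mu A Fb Y i).antisymm (G.gr1Mu_subset A h)

end Fixpoints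

/-! ### Correctness and amortised cost of the accelerated algorithm. -/

section Correctness

variable {V : Type*} [Finite V] (G : LiveGame V) {r s : ℕ} (A : Fin r → Set V)
  (F : Fin s → Set V)

omit [Finite V] in
theorem steps_symBody (Aa Fb Y X W : Set V) : (G.symBody Aa Fb Y X W).steps = 12 := rfl

/-- The warm-started iteration over `Yₐ` is correct if it starts above the fixpoint. -/
theorem descend_symBody {Aa Fb Y X W : Set V} (h : G.gr1Nu Aa Fb Y X ⊆ W)
    {q : Symbolic (Set V × PUnit)}
    (hq : descend (fun W (t : PUnit) => do
      let W' ← G.symBody Aa Fb Y X W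
      pure (W', t)) W PUnit.unit = q) :
    q.val.1 = G.gr1Nu Aa Fb Y X ∧ q.steps + 14 * q.val.1.ncard ≤ 14 * W.ncard + 14 := by
  have hP : ∀ W, G.gr1Nu Aa Fb Y X ⊆ W →
      G.gr1Nu Aa Fb Y X ⊆ W ∩ G.gr1Body Aa Fb Y X W := by
    intro W hW
    refine Set.subset_inter hW ?_
    conv_lhs => rw [← G.gr1Body_gr1Nu Aa Fb Y X]
    exact G.gr1Body_mono Aa Fb subset_rfl subset_rfl hW
  -- The 12 steps of the body and the 2 of the loop give the factor 14.
  obtain ⟨t', h₁, h₂, -, h₄⟩ := descend_spec (P := fun W _ => G.gr1Nu Aa Fb Y X ⊆ W)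
    (Φ := fun _ => 0) (K := 12) (fun W _ hW => hP W hW)
    (fun W t _ => by simp [steps_symBody]) h hq
  refine ⟨(G.subset_gr1Nu h₂).antisymm h₁, ?_⟩
  linarith

/-- The potential of a store: the total size of the sets that are stored for rounds `i ≤ |V|`. -/
noncomputable def Store.potential (T : Store V r s) : ℕ :=
  ∑ p ∈ Finset.univ ×ˢ Finset.range (Nat.card V + 1) ×ˢ Finset.univ, (T p.1 p.2.1 p.2.2).ncard

omit [Finite V] in
-- Only one summand changes, and `hi` ensures that it is among those counted. The additive form
-- avoids subtraction.
theorem Store.potential_set (T : Store V r s) (b : Fin s) {i : ℕ} (hi : i ≤ Nat.card V)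
    (a : Fin r) (W : Set V) :
    (T.set b i a W).potential + (T b i a).ncard = T.potential + W.ncard := by
  classical
  have hp : (b, i, a) ∈ (Finset.univ : Finset (Fin s)) ×ˢ
      Finset.range (Nat.card V + 1) ×ˢ (Finset.univ : Finset (Fin r)) := by
    simpa using Nat.lt_succ_of_le hi
  unfold Store.potential
  rw [← Finset.add_sum_erase _ _ hp, ← Finset.add_sum_erase _ _ hp]
  have : ∀ p ∈ ((Finset.univ : Finset (Fin s)) ×ˢ Finset.range (Nat.card V + 1) ×ˢ
      (Finset.univ : Finset (Fin r))).erase (b, i, a),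
      (T.set b i a W p.1 p.2.1 p.2.2).ncard = (T p.1 p.2.1 p.2.2).ncard := by
    rintro ⟨b', i', a'⟩ hp'
    have : ¬ (b' = b ∧ i' = i ∧ a' = a) := by simpa using (Finset.mem_erase.1 hp').1
    simp [Store.set, this]
  rw [Finset.sum_congr rfl this]
  simp [Store.set]
  ring

/-- All stored sets contain the fixpoints they approximate. -/
def Store.Above (T : Store V r s) (Y : Set V) : Prop :=
  ∀ b i a, G.gr1Nu (A a) (F b) Y (G.gr1Stage A (F b) Y i) ⊆ T b i a

omit [Finite V] in
-- This justifies the warm starts: the stages, and hence the inner fixpoints, are monotone in `Y`,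
-- so values computed for a larger `Y` remain upper bounds.
theorem Store.Above.anti {T : Store V r s} {Y Y' : Set V} (h : T.Above G A F Y) (hY : Y' ⊆ Y) :
    T.Above G A F Y' := fun b i a =>
  (G.gr1Nu_mono (A a) (F b) hY (G.gr1Stage_mono A (F b) hY i)).trans (h b i a)

/-- Each `a` costs 14 steps for the last pass of its descent and 1 for the union; all other passes
are paid for by the drop of the potential. Entries for later `a` are still untouched when their turn
comes. -/
theorem foldlM_symRound {b : Fin s} {Y : Set V} {i : ℕ} (hi : i ≤ Nat.card V) {X : Set V}
    (l : List (Fin r)) {U : Set V} {T : Store V r s}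
    (h : ∀ a, G.gr1Nu (A a) (F b) Y X ⊆ T b i a) {q : Symbolic (Set V × Store V r s)}
    (hq : l.foldlM (init := (U, T)) (fun UT a => do
      let W ← descend (fun W (t : PUnit) => do
        let W' ← G.symBody (A a) (F b) Y X W
        pure (W', t)) (UT.2 b i a) PUnit.unit
      let U ← op (UT.1 ∪ W.1)
      pure (U, UT.2.set b i a W.1)) = q) :
    q.val.1 = U ∪ ⋃ a ∈ l, G.gr1Nu (A a) (F b) Y X ∧
    (q.val.2 = fun b' i' a' => if b' = b ∧ i' = i ∧ a' ∈ l then G.gr1Nu (A a') (F b) Y X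
      else T b' i' a') ∧
    q.steps + 14 * q.val.2.potential ≤ 15 * l.length + 14 * T.potential := by
  induction l generalizing U T q with
  | nil => subst hq; simp
  | cons a l ih =>
    subst hq
    rw [List.foldlM_cons]
    obtain ⟨h₁, h₂⟩ := G.descend_symBody (h a) rfl
    simp only [val_bind, steps_bind, val_op, steps_op, val_pure, steps_pure]
    rw [h₁] at h₂ ⊢
    have hset : ∀ a', G.gr1Nu (A a') (F b) Y X ⊆
        T.set b i a (G.gr1Nu (A a) (F b) Y X) b i a' := by
      intro a'
      by_cases ha : a' = a
      · subst ha; simp [Store.set]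
      · simpa [Store.set, ha] using h a'
    obtain ⟨h₃, h₄, h₅⟩ := ih (U := U ∪ G.gr1Nu (A a) (F b) Y X) hset rfl
    refine ⟨?_, ?_, ?_⟩
    · rw [h₃]
      simp [Set.union_assoc]
    · rw [h₄]
      funext b' i' a'
      by_cases hb : b' = b <;> by_cases hi' : i' = i <;> by_cases ha : a' = a <;>
        by_cases hl : a' ∈ l <;> simp [Store.set, hb, hi', ha, hl]
    · have := T.potential_set b hi a (G.gr1Nu (A a) (F b) Y X)
      simp only [List.length_cons]
      linarith

/-- A round over `X_b` is correct on stores above the fixpoints. -/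
theorem symRound_spec {b : Fin s} {Y : Set V} {i : ℕ} (hi : i ≤ Nat.card V) {X : Set V}
    {T : Store V r s} (h : ∀ a, G.gr1Nu (A a) (F b) Y X ⊆ T b i a) :
    (G.symRound A F b Y i X T).val.1 = ⋃ a, G.gr1Nu (A a) (F b) Y X ∧
    ((G.symRound A F b Y i X T).val.2 = fun b' i' a' =>
      if b' = b ∧ i' = i then G.gr1Nu (A a') (F b) Y X else T b' i' a') ∧
    (G.symRound A F b Y i X T).steps + 14 * (G.symRound A F b Y i X T).val.2.potential ≤
      15 * r + 14 * T.potential := by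
  simpa [symRound] using G.foldlM_symRound A F hi (List.finRange r) (U := ∅) h rfl

/-- For the goal `b`, the store holds the sets computed by a complete iteration over `X_b`. -/
def Store.Filled (T : Store V r s) (Y : Set V) (b : Fin s) : Prop :=
  ∃ k, G.gr1Stage A (F b) Y k = G.gr1Mu A (F b) Y ∧
    ∀ i < k, ∀ a, T b i a = G.gr1Nu (A a) (F b) Y (G.gr1Stage A (F b) Y i)

/-- The iteration over `X_b` is correct on stores above the fixpoints. -/
theorem ascend_symRound {b : Fin s} {Y : Set V} {T : Store V r s} (h : T.Above G A F Y)
    {q : Symbolic (Set V × Store V r s)} (hq : ascend (G.symRound A F b Y) 0 ∅ T = q) :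
    q.val.1 = G.gr1Mu A (F b) Y ∧ q.val.2.Above G A F Y ∧ q.val.2.Filled G A F Y b ∧
    (∀ b', b' ≠ b → q.val.2 b' = T b') ∧
    q.steps + 14 * q.val.2.potential ≤ (15 * r + 2) * (Nat.card V + 1) + 14 * T.potential := by
  -- Every round but the last adds a vertex, so `i ≤ X.ncard`; hence `i` stays in the range that the
  -- potential counts.
  let P : ℕ → Set V → Store V r s → Prop := fun i X S =>
    X = G.gr1Stage A (F b) Y i ∧ i ≤ X.ncard ∧ S.Above G A F Y ∧
    (∀ j < i, ∀ a, S b j a = G.gr1Nu (A a) (F b) Y (G.gr1Stage A (F b) Y j)) ∧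
    ∀ b', b' ≠ b → S b' = T b'
  have hcard : ∀ X : Set V, X.ncard ≤ Nat.card V := fun X =>
    (Set.ncard_le_ncard (Set.subset_univ X)).trans_eq (Set.ncard_univ V)
  have step : ∀ i X S, P i X S →
      (G.symRound A F b Y i X S).val.1 = ⋃ a, G.gr1Nu (A a) (F b) Y X ∧
      (G.symRound A F b Y i X S).val.2.Above G A F Y ∧
      (∀ j < i + 1, ∀ a, (G.symRound A F b Y i X S).val.2 b j a =
        G.gr1Nu (A a) (F b) Y (G.gr1Stage A (F b) Y j)) ∧
      (∀ b', b' ≠ b → (G.symRound A F b Y i X S).val.2 b' = T b') ∧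
      (G.symRound A F b Y i X S).steps + 14 * (G.symRound A F b Y i X S).val.2.potential ≤
        15 * r + 14 * S.potential := by
    rintro i X S ⟨rfl, hi, hS, hj, hb⟩
    obtain ⟨h₁, h₂, h₃⟩ := G.symRound_spec A F (hi.trans (hcard _)) (fun a => hS b i a)
    refine ⟨h₁, ?_, ?_, ?_, h₃⟩
    · intro b' i' a'
      rw [h₂]
      dsimp only
      split_ifs with hif
      · obtain ⟨rfl, rfl⟩ := hif
        exact subset_rfl
      · exact hS b' i' a'
    · intro j hji a
      rw [h₂]
      by_cases hjeq : j = i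
      · simp [hjeq]
      · simpa [hjeq] using hj j (by omega) a
    · intro b' hb'
      rw [h₂, ← hb b' hb']
      simp [hb']
  have h₀ : P 0 ∅ T := ⟨rfl, Nat.zero_le _, h, fun j hj => absurd hj (Nat.not_lt_zero j),
    fun _ _ => rfl⟩
  have hP : ∀ i X S, P i X S → X ∪ (G.symRound A F b Y i X S).val.1 ≠ X →
      P (i + 1) (X ∪ (G.symRound A F b Y i X S).val.1) (G.symRound A F b Y i X S).val.2 := by
    intro i X S hPi hne
    obtain ⟨h₁, h₂, h₃, h₄, -⟩ := step i X S hPi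
    refine ⟨?_, ?_, h₂, h₃, h₄⟩
    · rw [h₁, hPi.1]
      rfl
    · exact Nat.succ_le_of_lt (hPi.2.1.trans_lt
        (Set.ncard_lt_ncard (Set.subset_union_left.ssubset_of_ne (Ne.symm hne))))
  obtain ⟨j, S, hPj, hsub, hval, hsteps⟩ := ascend_spec
    (Φ := fun S : Store V r s => 14 * S.potential) (K := 15 * r) hP
    (fun i X S hPi => (step i X S hPi).2.2.2.2) h₀ hq
  obtain ⟨h₁, h₂, h₃, h₄, -⟩ := step j _ S hPj
  rw [← hval] at h₂ h₃ h₄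
  have hX := hPj.1
  rw [h₁, hX] at hsub
  have hmu := G.gr1Stage_eq_gr1Mu A hsub
  refine ⟨hX.trans hmu, h₂, ⟨j, hmu, fun i hi => h₃ i (by omega)⟩, h₄, ?_⟩
  have := Nat.mul_le_mul_left (15 * r + 2) (Nat.succ_le_succ (hcard (∅ᶜ : Set V)))
  simp only [Nat.succ_eq_add_one] at this
  linarith

/-- A goal once filled remains so, because the iteration for another goal leaves its entries alone.
-/
theorem foldlM_symOuter {Y : Set V} (l : List (Fin s)) {J : Set V} {T : Store V r s}
    (h : T.Above G A F Y) {q : Symbolic (Set V × Store V r s)}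
    (hq : l.foldlM (init := (J, T)) (fun JT b => do
      let X ← ascend (G.symRound A F b Y) 0 ∅ JT.2
      let J ← op (JT.1 ∩ X.1)
      pure (J, X.2)) = q) :
    q.val.1 = J ∩ ⋂ b ∈ l, G.gr1Mu A (F b) Y ∧ q.val.2.Above G A F Y ∧
    (∀ b, b ∈ l ∨ T.Filled G A F Y b → q.val.2.Filled G A F Y b) ∧
    q.steps + 14 * q.val.2.potential ≤
      ((15 * r + 2) * (Nat.card V + 1) + 1) * l.length + 14 * T.potential := by
  induction l generalizing J T q with
  | nil => subst hq; simpa using h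
  | cons b l ih =>
    subst hq
    rw [List.foldlM_cons]
    obtain ⟨h₁, h₂, h₃, h₄, h₅⟩ := G.ascend_symRound A F (b := b) h rfl
    simp only [val_bind, steps_bind, val_op, steps_op, val_pure, steps_pure]
    rw [h₁]
    obtain ⟨h₆, h₇, h₈, h₉⟩ := ih (J := J ∩ G.gr1Mu A (F b) Y) h₂ rfl
    refine ⟨?_, h₇, ?_, ?_⟩
    · rw [h₆]
      simp [Set.inter_assoc]
    · intro b' hb'
      by_cases hbb : b' = b
      · subst hbb
        exact h₈ b' (Or.inr h₃)
      · refine h₈ b' ?_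
        rcases hb' with hb' | ⟨k, hk, hkT⟩
        · exact Or.inl ((List.mem_cons.1 hb').resolve_left hbb)
        · exact Or.inr ⟨k, hk, by rwa [h₄ b' hbb]⟩
    · simp only [List.length_cons]
      linarith

theorem symOuter_spec {Y : Set V} {T : Store V r s} (h : T.Above G A F Y) :
    (G.symOuter A F Y T).val.1 = ⋂ b, G.gr1Mu A (F b) Y ∧
    (G.symOuter A F Y T).val.2.Above G A F Y ∧
    (∀ b, (G.symOuter A F Y T).val.2.Filled G A F Y b) ∧
    (G.symOuter A F Y T).steps + 14 * (G.symOuter A F Y T).val.2.potential ≤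
      ((15 * r + 2) * (Nat.card V + 1) + 1) * s + 14 * T.potential := by
  simpa [symOuter] using G.foldlM_symOuter A F (List.finRange s) (J := Set.univ) h rfl

/-- The accelerated algorithm computes the fixpoint, and stores complete iterations over all `X_b`
for the final value of `Y`. -/
theorem gr1Algorithm_spec :
    (G.gr1Algorithm A F).val.1 = G.gr1Fixpoint A F ∧
    (∀ b, (G.gr1Algorithm A F).val.2.Filled G A F (G.gr1Fixpoint A F) b) ∧
    (G.gr1Algorithm A F).steps ≤
      (((15 * r + 2) * (Nat.card V + 1) + 1) * s + 2) * (Nat.card V + 1) +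
        14 * (s * ((Nat.card V + 1) * r) * Nat.card V) := by
  have hP : ∀ Y (T : Store V r s), G.gr1Fixpoint A F ⊆ Y ∧ T.Above G A F Y →
      G.gr1Fixpoint A F ⊆ Y ∩ (G.symOuter A F Y T).val.1 ∧
      (G.symOuter A F Y T).val.2.Above G A F (Y ∩ (G.symOuter A F Y T).val.1) := by
    rintro Y T ⟨hY, hT⟩
    obtain ⟨h₆, h₇, -, -⟩ := G.symOuter_spec A F hT
    refine ⟨Set.subset_inter hY ?_, h₇.anti G A F Set.inter_subset_left⟩
    rw [h₆]
    exact (G.iInter_gr1Mu_gr1Fixpoint A F).superset.trans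
      (Set.iInter_mono fun b => G.gr1Mu_mono A (F b) hY)
  obtain ⟨T, ⟨h₁, h₂⟩, h₃, h₄, h₅⟩ := descend_spec
    (Φ := fun T : Store V r s => 14 * T.potential)
    (K := ((15 * r + 2) * (Nat.card V + 1) + 1) * s) hP
    (fun Y T h => (G.symOuter_spec A F h.2).2.2.2)
    (W := Set.univ) (t := fun _ _ _ => Set.univ)
    ⟨Set.subset_univ _, fun _ _ _ => Set.subset_univ _⟩ (rfl : G.gr1Algorithm A F = _)
  obtain ⟨h₆, -, h₇, -⟩ := G.symOuter_spec A F h₂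
  rw [h₆] at h₃
  have hval := (G.subset_gr1Fixpoint A F h₃).antisymm h₁
  -- The last round runs at the returned set itself, so the final store belongs to `Z*` and not to a
  -- larger `Y`.
  rw [← h₄, hval] at h₇
  refine ⟨hval, h₇, ?_⟩
  have hpot : Store.potential (fun _ _ _ => Set.univ : Store V r s) =
      s * ((Nat.card V + 1) * r) * Nat.card V := by
    simp [Store.potential, Set.ncard_univ]
  rw [hpot, Set.ncard_univ] at h₅
  exact (Nat.le_add_right _ _).trans ((Nat.le_add_right _ _).trans h₅)

theorem steps_gr1Algorithm_le [Nonempty V] [NeZero r] [NeZero s] :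
    (G.gr1Algorithm A F).steps ≤ 102 * Nat.card V ^ 2 * r * s := by
  refine (G.gr1Algorithm_spec A F).2.2.trans ?_
  obtain ⟨n, hn⟩ : ∃ n, Nat.card V = n + 1 := Nat.exists_eq_succ_of_ne_zero Nat.card_pos.ne'
  obtain ⟨p, rfl⟩ : ∃ p, r = p + 1 := Nat.exists_eq_succ_of_ne_zero (NeZero.ne r)
  obtain ⟨q, rfl⟩ : ∃ q, s = q + 1 := Nat.exists_eq_succ_of_ne_zero (NeZero.ne s)
  rw [hn]
  -- In the shifted variables the difference has only nonnegative coefficients; 102 is the bound's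
  -- value at `n = r = s = 1`.
  refine le_of_sub_nonneg (α := ℤ) ?_ |> Int.ofNat_le.1
  push_cast
  ring_nf
  positivity

end Correctness

end LiveGame

/-! ### Plays as compliant paths, and recurrence. -/

namespace GameGraph

variable {V : Type*} (G : GameGraph V)

/-- `π` is an infinite path that complies with the player 0 strategy `ρ`. -/
def Compliant (ρ : G.Strategy G.V0) (π : ℕ → V) : Prop :=
  ∀ i, G.E (π i) (π (i + 1)) ∧
    (π i ∈ G.V0 → π (i + 1) = ρ.next ((List.range i).map π) (π i))

theorem history_fst (ρ₀ : G.Strategy G.V0) (ρ₁ : G.Strategy G.V1) (v : V) (i : ℕ) :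
    (G.history ρ₀ ρ₁ v i).1 = (List.range i).map (G.play ρ₀ ρ₁ v) := by
  induction i with
  | zero => rfl
  | succ i ih =>
    rw [List.range_succ, List.map_append, ← ih]
    rfl

theorem play_succ_of_mem (ρ₀ : G.Strategy G.V0) (ρ₁ : G.Strategy G.V1) (v : V) {i : ℕ}
    (h : G.play ρ₀ ρ₁ v i ∈ G.V0) : G.play ρ₀ ρ₁ v (i + 1) =
      ρ₀.next ((List.range i).map (G.play ρ₀ ρ₁ v)) (G.play ρ₀ ρ₁ v i) := by
  rw [← history_fst]
  exact if_pos h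

theorem play_succ_of_notMem (ρ₀ : G.Strategy G.V0) (ρ₁ : G.Strategy G.V1) (v : V) {i : ℕ}
    (h : G.play ρ₀ ρ₁ v i ∉ G.V0) : G.play ρ₀ ρ₁ v (i + 1) =
      ρ₁.next ((List.range i).map (G.play ρ₀ ρ₁ v)) (G.play ρ₀ ρ₁ v i) := by
  rw [← history_fst]
  exact if_neg h

theorem compliant_play (ρ₀ : G.Strategy G.V0) (ρ₁ : G.Strategy G.V1) (v : V) :
    G.Compliant ρ₀ (G.play ρ₀ ρ₁ v) := by
  intro i
  refine ⟨?_, G.play_succ_of_mem ρ₀ ρ₁ v⟩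
  by_cases h : G.play ρ₀ ρ₁ v i ∈ G.V0
  · rw [G.play_succ_of_mem ρ₀ ρ₁ v h]
    exact ρ₀.valid _ _ h
  · rw [G.play_succ_of_notMem ρ₀ ρ₁ v h]
    exact ρ₁.valid _ _ h

/-- Every path that complies with `ρ₀` is the play against some player 1 strategy. -/
theorem Compliant.exists_play_eq {G : GameGraph V} (hE : ∀ v, ∃ w, G.E v w)
    {ρ₀ : G.Strategy G.V0} {π : ℕ → V} (h : G.Compliant ρ₀ π) :
    ∃ ρ₁, G.play ρ₀ ρ₁ (π 0) = π := by
  classical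
  choose d hd using hE
  let ρ₁ : G.Strategy G.V1 :=
    { next := fun w v => if π w.length = v then π (w.length + 1) else d v
      valid := fun w v _ => by
        split_ifs with hv
        · exact hv ▸ (h _).1
        · exact hd v }
  refine ⟨ρ₁, funext fun i => ?_⟩
  induction i using Nat.strong_induction_on with
  | _ i ih =>
    cases i with
    | zero => rfl
    | succ i =>
      have hi := ih i (Nat.lt_succ_self i)
      have hmap : (List.range i).map (G.play ρ₀ ρ₁ (π 0)) = (List.range i).map π :=
        List.map_congr_left fun j hj => ih j (by have := List.mem_range.1 hj; omega)
      by_cases hv : π i ∈ G.V0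
      · rw [G.play_succ_of_mem _ _ _ (by rwa [hi]), hmap, hi, (h i).2 hv]
      · rw [G.play_succ_of_notMem _ _ _ (by rwa [hi]), hmap, hi]
        simp [ρ₁]

end GameGraph

/-- Each of the finitely many vertices that do not recur is eventually gone. -/
theorem eventually_frequently_eq {V : Type*} [Finite V] (π : ℕ → V) :
    ∀ᶠ i in atTop, ∃ᶠ j in atTop, π j = π i := by
  have : ∀ᶠ i in atTop, ∀ v, (¬ ∃ᶠ j in atTop, π j = v) → π i ≠ v := by
    refine eventually_all.2 fun v => ?_
    by_cases h : ∃ᶠ j in atTop, π j = v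
    · exact Eventually.of_forall fun i hi => absurd h hi
    · filter_upwards [not_frequently.1 h] with i hi _ using hi
  filter_upwards [this] with i hi
  by_contra h
  exact hi _ h rfl

/-- A predicate on `Fin s` that is closed under the cyclic successor holds everywhere. -/
theorem Fin.forall_of_add_one {s : ℕ} [NeZero s] {p : Fin s → Prop} (h : ∀ b, p b → p (b + 1))
    {b₀ : Fin s} (h₀ : p b₀) (b : Fin s) : p b := by
  have key : ∀ n : ℕ, p ⟨(b₀ + n) % s, Nat.mod_lt _ (NeZero.pos s)⟩ := by
    intro n
    induction n with
    | zero =>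
      convert h₀ using 1
      exact Fin.ext (Nat.mod_eq_of_lt b₀.isLt)
    | succ n ih =>
      convert h _ ih using 1
      refine Fin.ext ?_
      rw [Fin.val_add, Fin.val_one', ← Nat.add_mod, add_assoc]
  convert key (b + (s - b₀)) using 1
  refine Fin.ext ?_
  have : (b₀ : ℕ) + (b + (s - b₀)) = b + s := by have := b₀.isLt; omega
  simp only [this, Nat.add_mod_right, Nat.mod_eq_of_lt b.isLt]

/-! ### Soundness: extracted strategies win from the fixpoint. -/

namespace LiveGame

section Soundness

variable {V : Type*} (G : LiveGame V) {r s : ℕ} (A : Fin r → Set V) (F : Fin s → Set V)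

/-- The disjunct with `Fb` lies in `Cpre(Y)`, hence in the `Cpre` part of `Apre` for the other goal.
This makes all inner fixpoints at `Z*` equal. -/
theorem gr1Mu_subset_gr1Mu {Fb Fb' Y : Set V} (hY : Y ⊆ G.gr1Mu A Fb' Y) :
    G.gr1Mu A Fb Y ⊆ G.gr1Mu A Fb' Y := by
  refine G.gr1Mu_subset A ?_
  conv_rhs => rw [← G.iUnion_gr1Nu_gr1Mu A Fb' Y]
  refine Set.iUnion_mono fun a => G.subset_gr1Nu ?_
  conv_lhs => rw [← G.gr1Body_gr1Nu]
  rintro v ((hv | hv) | hv)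
  · exact Or.inl (Or.inr (Or.inl (G.cpre_mono hY hv.2)))
  · exact Or.inl (Or.inr hv)
  · exact Or.inr hv

theorem gr1Mu_gr1Fixpoint (b : Fin s) :
    G.gr1Mu A (F b) (G.gr1Fixpoint A F) = G.gr1Fixpoint A F := by
  have h : ∀ b, G.gr1Fixpoint A F ⊆ G.gr1Mu A (F b) (G.gr1Fixpoint A F) := by
    intro b
    conv_lhs => rw [← G.iInter_gr1Mu_gr1Fixpoint A F]
    exact Set.iInter_subset _ b
  refine subset_antisymm ?_ (h b)
  conv_rhs => rw [← G.iInter_gr1Mu_gr1Fixpoint A F]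
  exact Set.subset_iInter fun b' => G.gr1Mu_subset_gr1Mu A (h b')

theorem gr1Body_subset_cpre {Aa Fb Y X W : Set V} (hX : X ⊆ Y) (hW : W ⊆ Y) :
    G.gr1Body Aa Fb Y X W ⊆ G.cpre Y := by
  rintro v ((hv | hv | hv) | hv)
  · exact hv.2
  · exact G.cpre_mono hX hv
  · exact Or.inr hv.2
  · exact G.cpre_mono hW hv.2

theorem exists_mem_gr1Nu_of_mem_gr1Stage {Fb Y : Set V} {i : ℕ} {v : V}
    (hv : v ∈ G.gr1Stage A Fb Y i) :
    ∃ j < i, ∃ a, v ∈ G.gr1Nu (A a) Fb Y (G.gr1Stage A Fb Y j) := by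
  induction i with
  | zero => exact hv.elim
  | succ i ih =>
    rcases hv with hv | hv
    · obtain ⟨j, hj, h⟩ := ih hv
      exact ⟨j, hj.trans (Nat.lt_succ_self i), h⟩
    · exact ⟨i, Nat.lt_succ_self i, Set.mem_iUnion.1 hv⟩

theorem rank_le {T : Store V r s} {b : Fin s} {i : ℕ} {a : Fin r} {v : V} (h : v ∈ T b i a) :
    rank T b v ≤ ((i * r + (a : ℕ) : ℕ) : ℕ∞) :=
  (iInf_le _ i).trans ((iInf_le _ a).trans (iInf_le _ h))

theorem exists_of_rank_lt {T : Store V r s} {b : Fin s} {v : V} {c : ℕ∞} (h : rank T b v < c) :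
    ∃ i, ∃ a : Fin r, v ∈ T b i a ∧ ((i * r + (a : ℕ) : ℕ) : ℕ∞) < c := by
  simpa only [rank, iInf_lt_iff, exists_prop] using h

section Rank

variable {F} {T : Store V r s} {Y : Set V} {b : Fin s} {k : ℕ}
  (hT : ∀ i < k, ∀ a, T b i a = G.gr1Nu (A a) (F b) Y (G.gr1Stage A (F b) Y i))

include hT

/-- As `a < r`, the code `j * r + a` is below `i * r` exactly when `j < i`. Stage membership thus
passes to any vertex of no greater rank. -/
theorem rank_lt_iff {i : ℕ} (hi : i ≤ k) {v : V} :
    rank T b v < ((i * r : ℕ) : ℕ∞) ↔ v ∈ G.gr1Stage A (F b) Y i := by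
  constructor
  · intro h
    obtain ⟨j, a, hv, hlt⟩ := exists_of_rank_lt h
    have hji : j < i :=
      lt_of_mul_lt_mul_right ((Nat.le_add_right _ _).trans_lt (Nat.cast_lt.1 hlt)) r.zero_le
    rw [hT j (hji.trans_le hi)] at hv
    exact G.gr1Stage_monotone A (F b) Y hji (G.gr1Nu_subset_gr1Stage A (F b) Y j a hv)
  · intro h
    obtain ⟨j, hj, a, hv⟩ := G.exists_mem_gr1Nu_of_mem_gr1Stage A h
    rw [← hT j (hj.trans_le hi)] at hv
    refine (rank_le hv).trans_lt (Nat.cast_lt.2 ?_)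
    calc j * r + a < j * r + r := Nat.add_lt_add_left a.isLt _
      _ = (j + 1) * r := by ring
      _ ≤ i * r := Nat.mul_le_mul_right r hj

theorem exists_rank_eq {v : V} (hv : v ∈ G.gr1Stage A (F b) Y k) :
    ∃ i < k, ∃ a, v ∈ G.gr1Nu (A a) (F b) Y (G.gr1Stage A (F b) Y i) ∧
      rank T b v = ((i * r + (a : ℕ) : ℕ) : ℕ∞) := by
  have hlt := (G.rank_lt_iff A hT le_rfl).2 hv
  obtain ⟨m, hm⟩ := ENat.ne_top_iff_exists.1 hlt.ne_top
  have hm' : rank T b v < ((m + 1 : ℕ) : ℕ∞) := by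
    rw [← hm]
    exact Nat.cast_lt.2 (Nat.lt_succ_self m)
  obtain ⟨i, a, hva, hia⟩ := exists_of_rank_lt hm'
  have heq : rank T b v = ((i * r + (a : ℕ) : ℕ) : ℕ∞) := by
    refine (rank_le hva).antisymm ?_
    rw [← hm]
    exact Nat.cast_le.2 (Nat.lt_succ_iff.1 (Nat.cast_lt.1 hia))
  have hik : i < k := by
    rw [heq] at hlt
    exact lt_of_mul_lt_mul_right ((Nat.le_add_right _ _).trans_lt (Nat.cast_lt.1 hlt)) r.zero_le
  rw [hT i hik] at hva
  exact ⟨i, hik, a, hva, heq⟩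

end Rank

/-- If the memory, a goal that moves on cyclically when it is reached, moves on infinitely often,
then all goals are reached infinitely often. -/
theorem frequently_mem_of_frequently_mem_goal [NeZero s] {F : Fin s → Set V} {π : ℕ → V}
    {m : ℕ → Fin s} (hmem : ∀ i, π i ∈ F (m i) → m (i + 1) = m i + 1)
    (hnot : ∀ i, π i ∉ F (m i) → m (i + 1) = m i) (h : ∃ᶠ i in atTop, π i ∈ F (m i))
    (b : Fin s) : ∃ᶠ i in atTop, π i ∈ F b := by
  have key : ∃ᶠ i in atTop, m i = b ∧ π i ∈ F (m i) := by
    -- Pigeonhole on the finitely many memory values. Afterwards, the first hit following one with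
    -- memory `b` has memory `b + 1`.
    obtain ⟨b₀, hb₀⟩ : ∃ b₀, ∃ᶠ i in atTop, m i = b₀ ∧ π i ∈ F (m i) := by
      by_contra! hcon
      refine h ?_
      filter_upwards [eventually_all.2 hcon] with i hi hF
      exact hi (m i) rfl hF
    refine Fin.forall_of_add_one (p := fun b => ∃ᶠ i in atTop, m i = b ∧ π i ∈ F (m i)) ?_ hb₀ b
    intro b hb
    rw [frequently_atTop] at hb h ⊢
    intro n
    obtain ⟨i, hni, hib, hiF⟩ := hb n
    have hex : ∃ j, π (i + 1 + j) ∈ F (m (i + 1 + j)) := by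
      obtain ⟨j, hj, hjF⟩ := h (i + 1)
      exact ⟨j - (i + 1), by rwa [Nat.add_sub_cancel' hj]⟩
    classical
    have hconst : ∀ j ≤ Nat.find hex, m (i + 1 + j) = b + 1 := by
      intro j
      induction j with
      | zero => intro _; rw [add_zero, hmem i hiF, hib]
      | succ j ih =>
        intro hj
        rw [← add_assoc, hnot _ (Nat.find_min hex hj), ih (by omega)]
    exact ⟨_, by omega, hconst _ le_rfl, Nat.find_spec hex⟩
  exact key.mono fun i hi => hi.1 ▸ hi.2

/-- Every strategy extracted from a store with complete iterations is winning from the fixpoint. -/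
theorem IsExtracted.winsWith [Finite V] [NeZero s] {T : Store V r s}
    (hT : ∀ b, T.Filled G A F (G.gr1Fixpoint A F) b) {σ : G.MemoryStrategy (Fin s)}
    (hσ : G.IsExtracted F T σ) {v : V} (hv : v ∈ G.gr1Fixpoint A F) :
    G.WinsWith (G.fairCondition (GR1Condition A F)) σ.toStrategy v := by
  intro ρ₁ hfair
  have hcomp := G.compliant_play σ.toStrategy ρ₁ v
  have h0 : G.play σ.toStrategy ρ₁ v 0 = v := rfl
  generalize G.play σ.toStrategy ρ₁ v = π at *
  obtain ⟨m, hm⟩ : ∃ m : ℕ → Fin s, ∀ i, m i = ((List.range i).map π).foldl σ.update σ.init :=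
    ⟨_, fun _ => rfl⟩
  have hm_succ : ∀ i, m (i + 1) = σ.update (m i) (π i) := by
    intro i
    rw [hm, hm, List.range_succ, List.map_append, List.foldl_append]
    rfl
  -- Player 0 does at least as well as by moving into `S`; player 1 has to move into `S`.
  have hcpre : ∀ i S, π i ∈ G.cpre S →
      ∃ u ∈ S, rank T (m (i + 1)) (π (i + 1)) ≤ rank T (m (i + 1)) u := by
    rintro i S (⟨hi, u, hu, huS⟩ | ⟨-, hi⟩)
    · refine ⟨u, huS, ?_⟩
      rw [(hcomp i).2 hi, hm_succ]
      change rank T _ (σ.move (((List.range i).map π).foldl σ.update σ.init) _) ≤ _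
      rw [← hm]
      exact hσ.move_min _ _ hi u hu
    · exact ⟨_, hi _ (hcomp i).1, le_rfl⟩
  choose k hk hkT using hT
  simp only [G.gr1Mu_gr1Fixpoint A F] at hk
  -- For every goal, membership in `Z*` is a rank bound, so the induction survives a change of goal.
  have hZ : ∀ i, π i ∈ G.gr1Fixpoint A F := by
    intro i
    induction i with
    | zero => rwa [h0]
    | succ i ih =>
      have hmem : π i ∈ G.cpre (G.gr1Fixpoint A F) := by
        rw [← hk (m i)] at ih
        obtain ⟨j, hj, a, hja⟩ := G.exists_mem_gr1Nu_of_mem_gr1Stage A ih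
        rw [← G.gr1Body_gr1Nu] at hja
        refine G.gr1Body_subset_cpre ?_ ?_ hja
        · conv_rhs => rw [← hk (m i)]
          exact G.gr1Stage_monotone A _ _ hj.le
        · conv_rhs => rw [← hk (m i)]
          exact (G.gr1Nu_subset_gr1Stage A _ _ j a).trans (G.gr1Stage_monotone A _ _ hj)
      obtain ⟨u, hu, hle⟩ := hcpre i _ hmem
      rw [← hk (m (i + 1))] at hu ⊢
      rw [← G.rank_lt_iff A (hkT (m (i + 1))) le_rfl] at hu ⊢
      exact hle.trans_lt hu
  intro hA
  by_cases hfreq : ∃ᶠ i in atTop, π i ∈ F (m i)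
  · exact frequently_mem_of_frequently_mem_goal
      (fun i hi => (hm_succ i).trans (hσ.update_of_mem _ _ hi))
      (fun i hi => (hm_succ i).trans (hσ.update_of_notMem _ _ hi)) hfreq
  exfalso
  obtain ⟨n, hn⟩ := eventually_atTop.1
    ((not_frequently.1 hfreq).and (eventually_frequently_eq π))
  have hmn : ∀ i ≥ n, m i = m n := by
    intro i hi
    induction i, hi using Nat.le_induction with
    | base => rfl
    | succ i hi ih => rw [hm_succ, hσ.update_of_notMem _ _ (hn i hi).1, ih]
  generalize m n = b at hmn
  obtain ⟨v₀, hv₀, hmin⟩ := Set.exists_min_image {v | ∃ᶠ j in atTop, π j = v} (rank T b)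
    (Set.toFinite _) ⟨_, (hn n le_rfl).2⟩
  have hv₀Z : v₀ ∈ G.gr1Fixpoint A F := by
    obtain ⟨j, rfl⟩ := hv₀.exists
    exact hZ j
  rw [← hk b] at hv₀Z
  obtain ⟨i₀, hi₀, a₀, -, hrank₀⟩ := G.exists_rank_eq A (hkT b) hv₀Z
  have hno : ∀ u, (∃ᶠ j in atTop, π j = u) →
      u ∉ G.gr1Stage A (F b) (G.gr1Fixpoint A F) i₀ := by
    intro u hu hmem
    rw [← G.rank_lt_iff A (hkT b) hi₀.le] at hmem
    have := (hmin u hu).trans_lt hmem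
    rw [hrank₀] at this
    exact absurd (Nat.cast_lt.1 this) (by omega)
  -- Equal rank means the same pair `(i₀, a₀)`, so `π i` lies in that inner fixpoint; three of the
  -- four ways to be in its body are contradictory.
  have hstep : ∀ i ≥ n, rank T b (π i) = rank T b v₀ →
      π i ∉ A a₀ ∧ rank T b (π (i + 1)) = rank T b v₀ := by
    intro i hi hr
    have hiZ := hZ i
    rw [← hk b] at hiZ
    obtain ⟨i₁, hi₁, a₁, hmem, hrank₁⟩ := G.exists_rank_eq A (hkT b) hiZ
    have hcode : i₁ * r + a₁ = i₀ * r + a₀ := by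
      have := hrank₁.symm.trans (hr.trans hrank₀)
      exact Nat.cast_injective this
    have hrpos : 0 < r := a₀.pos
    obtain rfl : i₁ = i₀ := by
      have := congrArg (· / r) hcode
      simpa [Nat.add_div_of_dvd_right, Nat.div_eq_of_lt, hrpos.ne', hrpos] using this
    obtain rfl : a₁ = a₀ := Fin.ext (Nat.add_left_cancel hcode)
    have hle : ∀ S, π i ∈ G.cpre S → ∃ u ∈ S, rank T b (π (i + 1)) ≤ rank T b u := by
      intro S hS
      have := hcpre i S hS
      rwa [hmn (i + 1) (by omega)] at this
    have hnext := (hn (i + 1) (by omega)).2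
    have hF : π i ∉ F b := by
      have := (hn i hi).1
      rwa [hmn i hi] at this
    rw [← G.gr1Body_gr1Nu] at hmem
    rcases hmem with ((hmem | hmem | hmem) | hmem)
    · exact absurd hmem.1 hF
    · obtain ⟨u, hu, hur⟩ := hle _ hmem
      refine absurd ?_ (hno _ hnext)
      rw [← G.rank_lt_iff A (hkT b) hi₁.le] at hu ⊢
      exact hur.trans_lt hu
    · obtain ⟨u, hlive, hu⟩ := hmem.1
      refine absurd hu (hno u ?_)
      have hf : ∃ᶠ j in atTop, π (j + 1) = u :=
        (hfair _ u hlive (hn i hi).2).mono fun j hj => hj.2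
      rw [frequently_atTop] at hf ⊢
      intro N
      obtain ⟨j, hj, hju⟩ := hf N
      exact ⟨j + 1, by omega, hju⟩
    · obtain ⟨u, hu, hur⟩ := hle _ hmem.2
      refine ⟨hmem.1, (hur.trans ?_).antisymm (hmin _ hnext)⟩
      rw [hrank₀]
      rw [← hkT b i₁ hi₁] at hu
      exact rank_le hu
  obtain ⟨n₁, hn₁, hn₁v⟩ := frequently_atTop.1 hv₀ n
  have hall : ∀ i ≥ n₁, rank T b (π i) = rank T b v₀ := by
    intro i hi
    induction i, hi using Nat.le_induction with
    | base => rw [hn₁v]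
    | succ i hi ih => exact (hstep i (hn₁.trans hi) ih).2
  obtain ⟨i, hi, hiA⟩ := frequently_atTop.1 (hA a₀) n₁
  exact (hstep i (hn₁.trans hi) (hall i hi)).1 hiA

theorem exists_isExtracted [NeZero s] (hE : ∀ v, ∃ w, G.E v w) (T : Store V r s) :
    ∃ σ : G.MemoryStrategy (Fin s), G.IsExtracted F T σ := by
  classical
  have hmin : ∀ b v, ∃ w, G.E v w ∧ ∀ u, G.E v u → rank T b w ≤ rank T b u := by
    intro b v
    obtain ⟨w, hw, hmin⟩ := WellFounded.has_min (InvImage.wf (rank T b) wellFounded_lt)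
      {w | G.E v w} (hE v)
    exact ⟨w, hw, fun u hu => not_lt.1 (hmin u hu)⟩
  choose f hf hfmin using hmin
  let upd : Fin s → V → Fin s := fun b v => if v ∈ F b then b + 1 else b
  exact ⟨⟨0, upd, fun b v => f (upd b v) v, fun b v _ => hf _ v⟩, fun _ _ h => if_pos h,
    fun _ _ h => if_neg h, fun b v _ w hw => hfmin _ v w hw⟩

end Soundness

end LiveGame

/-! ### A round-robin strategy of player 1. -/

theorem frequently_atTop_add_iff {p : ℕ → Prop} (n : ℕ) :
    (∃ᶠ k in atTop, p (k + n)) ↔ ∃ᶠ k in atTop, p k := by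
  conv_rhs => rw [← map_add_atTop_eq_nat n]
  exact frequently_map.symm

theorem List.count_map_range {V : Type*} [DecidableEq V] (π : ℕ → V) (v : V) (i : ℕ) :
    ((List.range i).map π).count v = Nat.count (fun j => π j = v) i := by
  induction i with
  | zero => rfl
  | succ i ih =>
    rw [List.range_succ, List.map_append, List.count_append, ih, Nat.count_succ]
    by_cases h : π i = v <;> simp [h]

/-- A nonempty countable set has an enumeration that hits every element infinitely often. -/
theorem Set.Countable.exists_frequently_eq {V : Type*} {S : Set V} (hc : S.Countable)
    (hS : S.Nonempty) :
    ∃ g : ℕ → V, (∀ k, g k ∈ S) ∧ ∀ w ∈ S, ∃ᶠ k in atTop, g k = w := by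
  obtain ⟨f, rfl⟩ := hc.exists_eq_range hS
  refine ⟨fun k => f k.unpair.1, fun k => ⟨_, rfl⟩, ?_⟩
  rintro _ ⟨n, rfl⟩
  exact frequently_atTop.2 fun N => ⟨Nat.pair n N, Nat.right_le_pair n N, by simp⟩

namespace GameGraph

variable {V : Type*} (G : GameGraph V)

/-- Player 1 can give preference to the successors in `N`, and take them in turn. -/
theorem exists_roundRobin [Finite V] (hE : ∀ v, ∃ w, G.E v w) (N : Set V) :
    ∃ ρ₁ : G.Strategy G.V1, ∀ ρ₀ v₀,
      (∀ i, G.play ρ₀ ρ₁ v₀ i ∈ G.V1 → (∃ w ∈ N, G.E (G.play ρ₀ ρ₁ v₀ i) w) →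
        G.play ρ₀ ρ₁ v₀ (i + 1) ∈ N) ∧
      ∀ v ∈ G.V1, ∀ w ∈ N, G.E v w → (∃ᶠ i in atTop, G.play ρ₀ ρ₁ v₀ i = v) →
        ∃ᶠ i in atTop, G.play ρ₀ ρ₁ v₀ i = v ∧ G.play ρ₀ ρ₁ v₀ (i + 1) = w := by
  classical
  have hg : ∀ v, ∃ g : ℕ → V, (∀ k, G.E v (g k)) ∧ ((∃ w ∈ N, G.E v w) → ∀ k, g k ∈ N) ∧
      ∀ w ∈ N, G.E v w → ∃ᶠ k in atTop, g k = w := by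
    intro v
    by_cases h : ∃ w ∈ N, G.E v w
    · obtain ⟨g, hg, hfreq⟩ := (Set.to_countable {w | w ∈ N ∧ G.E v w}).exists_frequently_eq h
      exact ⟨g, fun k => (hg k).2, fun _ k => (hg k).1, fun w hw hvw => hfreq w ⟨hw, hvw⟩⟩
    · obtain ⟨d, hd⟩ := hE v
      exact ⟨fun _ => d, fun _ => hd, fun h' => absurd h' h,
        fun w hw hvw => absurd ⟨w, hw, hvw⟩ h⟩
  choose g hgE hgN hgfreq using hg
  -- The `k`-th visit to `v`, counted from 0, takes the `k`-th entry of its enumeration.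
  let ρ₁ : G.Strategy G.V1 := ⟨fun w v => g v (w.count v), fun w v _ => hgE v _⟩
  refine ⟨ρ₁, fun ρ₀ v₀ => ?_⟩
  have hsucc : ∀ i, G.play ρ₀ ρ₁ v₀ i ∈ G.V1 → G.play ρ₀ ρ₁ v₀ (i + 1) =
      g (G.play ρ₀ ρ₁ v₀ i)
        (Nat.count (fun j => G.play ρ₀ ρ₁ v₀ j = G.play ρ₀ ρ₁ v₀ i) i) := by
    intro i hi
    rw [G.play_succ_of_notMem ρ₀ ρ₁ v₀ hi]
    exact congrArg (g _) (List.count_map_range _ _ _)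
  generalize G.play ρ₀ ρ₁ v₀ = π at hsucc
  refine ⟨fun i hi hw => hsucc i hi ▸ hgN _ hw _, fun v hv w hw hvw hfreq => ?_⟩
  have hinf : {i | π i = v}.Infinite := Nat.frequently_atTop_iff_infinite.1 hfreq
  refine frequently_atTop.2 fun n => ?_
  obtain ⟨k, hk, hkw⟩ := frequently_atTop.1 (hgfreq v w hw hvw) n
  have hi : π (Nat.nth (fun i => π i = v) k) = v := Nat.nth_mem_of_infinite hinf k
  have hcount : Nat.count (fun i => π i = v) (Nat.nth (fun i => π i = v) k) = k :=
    Nat.count_nth_of_infinite hinf k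
  refine ⟨Nat.nth (fun i => π i = v) k, ?_, hi, ?_⟩
  · have := Nat.count_le (p := fun i => π i = v) (n := Nat.nth (fun i => π i = v) k)
    omega
  · rw [hsucc _ (by rwa [hi]), hi, hcount, hkw]

end GameGraph

/-! ### Completeness: the winning region lies in the fixpoint. -/

namespace LiveGame

section Completeness

variable {V : Type*} (G : LiveGame V) {r s : ℕ} (A : Fin r → Set V) (F : Fin s → Set V)

/-- The plays that player 1 wants: fair ones that violate the condition. -/
theorem notMem_fairWinningRegion_iff (hE : ∀ v, ∃ w, G.E v w) {φ : Set (ℕ → V)} {v : V} :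
    v ∉ G.fairWinningRegion φ ↔
      ∀ ρ₀, ∃ π, π 0 = v ∧ G.Compliant ρ₀ π ∧ π ∉ G.fairCondition φ := by
  simp only [fairWinningRegion, GameGraph.winningRegion, GameGraph.WinsWith, Set.mem_ofPred_eq,
    not_exists, not_forall]
  refine forall_congr' fun ρ₀ => ⟨?_, ?_⟩
  · rintro ⟨ρ₁, h⟩
    exact ⟨_, rfl, G.compliant_play ρ₀ ρ₁ v, h⟩
  · rintro ⟨π, rfl, hπ, h⟩
    obtain ⟨ρ₁, hρ₁⟩ := hπ.exists_play_eq hE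
    exact ⟨ρ₁, by rwa [hρ₁]⟩

/-- Fairness and GR(1) depend only on what happens infinitely often, so a finite prefix is
irrelevant. -/
theorem mem_fairCondition_gr1Condition_of_shift {π π' : ℕ → V} {n : ℕ}
    (h : ∀ k, π (k + n) = π' k) (hπ : π ∈ G.fairCondition (GR1Condition A F)) :
    π' ∈ G.fairCondition (GR1Condition A F) := by
  have hset : ∀ S : Set V, (∃ᶠ k in atTop, π' k ∈ S) ↔ ∃ᶠ k in atTop, π k ∈ S := by
    intro S
    rw [← frequently_atTop_add_iff (p := fun k => π k ∈ S) n]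
    simp only [h]
  intro hfair hA b
  refine (hset _).2 (hπ ?_ (fun a => (hset _).1 (hA a)) b)
  intro v w hvw hv
  rw [← frequently_atTop_add_iff n]
  have := hfair v w hvw ((hset {v}).2 hv)
  refine this.mono fun k hk => ?_
  rw [h, add_right_comm, h]
  exact hk

/-- A compliant path that can leave the winning region can be continued to a play that
player 1 wins. -/
theorem exists_of_compliant_of_notMem (hE : ∀ v, ∃ w, G.E v w) {ρ₀ : G.Strategy G.V0}
    {π : ℕ → V} (hπ : G.Compliant ρ₀ π) {i : ℕ} {u : V} (hu : G.E (π i) u)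
    (hu₀ : π i ∈ G.V0 → u = ρ₀.next ((List.range i).map π) (π i))
    (huW : u ∉ G.fairWinningRegion (GR1Condition A F)) :
    ∃ τ, τ 0 = π 0 ∧ G.Compliant ρ₀ τ ∧ τ ∉ G.fairCondition (GR1Condition A F) := by
  -- The residual of `ρ₀` after the history up to `π i` does not win from `u`; a counterplay to it
  -- is appended to that history.
  obtain ⟨π', h0, hcomp, hbad⟩ := (G.notMem_fairWinningRegion_iff hE).1 huW
    ⟨fun w v => ρ₀.next ((List.range (i + 1)).map π ++ w) v, fun w v hv => ρ₀.valid _ v hv⟩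
  obtain ⟨τ, hle, hgt⟩ : ∃ τ : ℕ → V, (∀ k ≤ i, τ k = π k) ∧ ∀ k, τ (k + (i + 1)) = π' k := by
    refine ⟨fun k => if k ≤ i then π k else π' (k - (i + 1)), fun k hk => if_pos hk, fun k => ?_⟩
    simp only [Nat.add_sub_cancel]
    exact if_neg (by omega)
  have hmap : ∀ k ≤ i + 1, (List.range k).map τ = (List.range k).map π := fun k hk =>
    List.map_congr_left fun j hj => hle j (by have := List.mem_range.1 hj; omega)
  have hmap' : ∀ k, (List.range (k + (i + 1))).map τ =
      (List.range (i + 1)).map π ++ (List.range k).map π' := by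
    intro k
    induction k with
    | zero => simpa using hmap (i + 1) le_rfl
    | succ k ih =>
      rw [add_right_comm, List.range_succ, List.map_append, ih, List.range_succ (n := k),
        List.map_append, List.append_assoc]
      simp [hgt]
  refine ⟨τ, hle 0 (Nat.zero_le i), fun k => ?_,
    fun h => hbad (G.mem_fairCondition_gr1Condition_of_shift A F hgt h)⟩
  rcases lt_trichotomy k i with hk | rfl | hk
  · rw [hle k hk.le, hle (k + 1) hk, hmap k (by omega)]
    exact hπ k
  · have : τ (k + 1) = u := by rw [← h0, ← hgt 0, zero_add]
    rw [hle k le_rfl, this, hmap k (by omega)]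
    exact ⟨hu, hu₀⟩
  · obtain ⟨j, rfl⟩ : ∃ j, k = j + (i + 1) := ⟨k - (i + 1), by omega⟩
    rw [hgt, add_right_comm, hgt, hmap']
    exact hcomp j

/-- The winning region is a post-fixpoint of the outer iteration. -/
theorem fairWinningRegion_subset_gr1Mu [Finite V] [NeZero r] (hE : ∀ v, ∃ w, G.E v w)
    (b : Fin s) : G.fairWinningRegion (GR1Condition A F) ⊆
      G.gr1Mu A (F b) (G.fairWinningRegion (GR1Condition A F)) := by
  set Y := G.fairWinningRegion (GR1Condition A F) with hY
  set M := G.gr1Mu A (F b) Y with hM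
  have hnu : ∀ a, G.gr1Nu (A a) (F b) Y M ⊆ M := by
    intro a
    conv_rhs => rw [hM, ← G.iUnion_gr1Nu_gr1Mu A (F b) Y]
    exact Set.subset_iUnion (fun a => G.gr1Nu (A a) (F b) Y M) a
  have hbase : (F b ∩ G.cpre Y) ∪ G.apre Y M ⊆ M := by
    refine subset_trans ?_ (hnu 0)
    rw [← G.gr1Body_gr1Nu]
    exact Set.subset_union_left
  have hMbase : M ⊆ (F b ∩ G.cpre Y) ∪ G.apre Y M := by
    intro v hv
    rw [hM, ← G.iUnion_gr1Nu_gr1Mu A (F b) Y] at hv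
    obtain ⟨a, ha⟩ := Set.mem_iUnion.1 hv
    rw [← G.gr1Body_gr1Nu] at ha
    rcases ha with ha | ha
    · exact ha
    · exact Or.inr (Or.inl (G.cpre_mono (hnu a) ha.2))
  intro v₀ hv₀Y
  by_contra hv₀M
  refine absurd hv₀Y ((G.notMem_fairWinningRegion_iff hE).2 fun ρ₀ => ?_)
  obtain ⟨ρ₁, hρ₁⟩ := G.exists_roundRobin hE Mᶜ
  obtain ⟨hstay, hturn⟩ := hρ₁ ρ₀ v₀
  have hcomp := G.compliant_play ρ₀ ρ₁ v₀
  have h0 : G.play ρ₀ ρ₁ v₀ 0 = v₀ := rfl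
  generalize G.play ρ₀ ρ₁ v₀ = π at *
  by_cases hcpre : ∃ i, π i ∉ G.cpre Y
  · obtain ⟨i, hi⟩ := hcpre
    rw [← h0]
    by_cases hi₀ : π i ∈ G.V0
    · exact G.exists_of_compliant_of_notMem A F hE hcomp (hcomp i).1 (fun _ => (hcomp i).2 hi₀)
        fun hmem => hi (Or.inl ⟨hi₀, _, (hcomp i).1, hmem⟩)
    · obtain ⟨u, hu, huY⟩ : ∃ u, G.E (π i) u ∧ u ∉ Y := by
        by_contra! hcon
        exact hi (Or.inr ⟨hi₀, hcon⟩)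
      exact G.exists_of_compliant_of_notMem A F hE hcomp hu (fun h => absurd h hi₀) huY
  push Not at hcpre
  refine ⟨π, h0, hcomp, fun hwin => ?_⟩
  have hM' : ∀ i, π i ∉ M := by
    intro i
    induction i with
    | zero => rwa [h0]
    | succ i ih =>
      have hnot : π i ∉ G.cpre M := fun h => ih (hbase (Or.inr (Or.inl h)))
      by_cases hi₀ : π i ∈ G.V0
      · exact fun h => hnot (Or.inl ⟨hi₀, _, (hcomp i).1, h⟩)
      · refine hstay i hi₀ ?_
        by_contra! hcon
        exact hnot (Or.inr ⟨hi₀, fun w hw => by_contra fun hwM => hcon w hwM hw⟩)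
  have hfair : G.Fair π := by
    intro v w hvw hfreq
    obtain ⟨i, rfl⟩ := hfreq.exists
    obtain ⟨hv, hE'⟩ := G.live_sub _ _ hvw
    refine hturn _ hv w (fun hwM => hM' i (hbase (Or.inr (Or.inr ⟨⟨w, hvw, hwM⟩, ?_⟩)))) hE' hfreq
    exact (hcpre i).resolve_left fun h => hv h.1
  have hA : ∀ a, ∃ᶠ i in atTop, π i ∈ A a := by
    intro a
    by_contra hcon
    obtain ⟨n, hn⟩ := (eventually_frequently_eq π).exists
    refine hM' n (hnu a (G.subset_gr1Nu (W := {v | ∃ᶠ j in atTop, π j = v} ∪ M) ?_ (Or.inl hn)))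
    rintro v (hv | hv)
    · refine Or.inr ⟨fun hvA => hcon (hv.mono fun i hi => hi ▸ hvA), ?_⟩
      by_cases hv₀ : v ∈ G.V0
      · obtain ⟨i, rfl, hi⟩ := (hv.and_eventually
          ((tendsto_add_atTop_nat 1).eventually (eventually_frequently_eq π))).exists
        exact Or.inl ⟨hv₀, _, (hcomp i).1, Or.inl hi⟩
      · refine Or.inr ⟨hv₀, fun w hw => or_iff_not_imp_right.2 fun hwM => ?_⟩
        have := (hturn v hv₀ w hwM hw hv).mono fun i hi => hi.2
        exact (frequently_atTop_add_iff (p := fun i => π i = w) 1).1 this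
    · exact Or.inl (hMbase hv)
  obtain ⟨i, hi⟩ := (hwin hfair hA b).exists
  exact hM' i (hbase (Or.inl ⟨hi, hcpre i⟩))

end Completeness

end LiveGame

theorem mainTheorem6 :
    ∃ C : ℕ, ∀ (V : Type*) [Finite V] [Nonempty V] (G : LiveGame V)
      (_ : ∀ v, ∃ w, G.E v w) (r s : ℕ) [NeZero r] [NeZero s]
      (A : Fin r → Set V) (F : Fin s → Set V),
      -- the fixpoint is the winning region of the fair adversarial GR(1) game
      G.gr1Fixpoint A F = G.fairWinningRegion (GR1Condition A F) ∧
      -- the algorithm computes the fixpoint in `O(n² r s)` symbolic steps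
      (G.gr1Algorithm A F).val.1 = G.gr1Fixpoint A F ∧
      (G.gr1Algorithm A F).steps ≤ C * Nat.card V ^ 2 * r * s ∧
      -- a finite-memory strategy extracted from the computed sets wins from the whole region
      ∃ σ : G.MemoryStrategy (Fin s), G.IsExtracted F (G.gr1Algorithm A F).val.2 σ ∧
        ∀ v ∈ G.gr1Fixpoint A F,
          G.WinsWith (G.fairCondition (GR1Condition A F)) σ.toStrategy v := by
  refine ⟨102, fun V _ _ G hE r s _ _ A F => ?_⟩
  obtain ⟨σ, hσ⟩ := G.exists_isExtracted F hE (G.gr1Algorithm A F).val.2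
  have hwin : ∀ v ∈ G.gr1Fixpoint A F,
      G.WinsWith (G.fairCondition (GR1Condition A F)) σ.toStrategy v :=
    fun v hv => hσ.winsWith G A F (G.gr1Algorithm_spec A F).2.1 hv
  refine ⟨subset_antisymm (fun v hv => ⟨_, hwin v hv⟩) (G.subset_gr1Fixpoint A F ?_),
    (G.gr1Algorithm_spec A F).1, G.steps_gr1Algorithm_le A F, σ, hσ, hwin⟩
  exact Set.subset_iInter fun b => G.fairWinningRegion_subset_gr1Mu A F hE b
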